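/- For $n\ge 1$ let $AQ_n$ be the augmented cube, the graph on the binary strings of length $n$ defined recursively: $AQ_1=K_2$; for $n\ge 2$, two strings $au$ and $bv$ with $a,b\in\{0,1\}$ and $u,v\in\{0,1\}^{n-1}$ are adjacent in $AQ_n$ if and only if either $a=b$ and $u,v$ are adjacent in $AQ_{n-1}$, or $a\ne b$ and ($u=v$, or $u$ and $v$ differ in every position). A fractional perfect matching of a finite graph $H$ is a function $f:E(H)\to[0,1]$ such that $\sum_{e\ni v}f(e)=1$ for every vertex $v$ of $H$. For a finite graph $G$ and a set $F$ of vertices and edges of $G$, let $G-F$ be the graph obtained from $G$ by deleting the vertices in $F$ (with all edges incident to them) and the edges in $F$. The set $F$ is a fractional strong matching preclusion set (FSMP set) of $G$ if $G-F$ has no fractional perfect matching; $fsmp(G)$ is the minimum size of an FSMP set of $G$, and $\delta(G)$ is the minimum degree of $G$. The graph $G$ is fractional strongly maximally matched if $fsmp(G)=\delta(G)$; it is fractional strongly super matched if, in addition, $G-F$ has an isolated vertex for every FSMP set $F$ of $G$ with $|F|=fsmp(G)$. **Lemma 4.1.** $AQ_4$ is fractional strongly maximally matched and fractional strongly super matched.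 -/

import Mathlib

namespace SimpleGraph

/-- The `n`-dimensional augmented cube on the binary strings of length `n`. The first digit
(index `0`) says which of the two copies of the `(n-1)`-dimensional cube a vertex lies in.
Two vertices with different first digits are adjacent if the remaining strings are equal
(cross edge) or complementary (complement edge). Dimension `0` is a placeholder. -/
def augmentedCube : (n : ℕ) → SimpleGraph (Fin n → Bool)
  | 0 => ⊥
  | 1 => ⊤
  | n + 2 =>
    { Adj := fun u v =>
        (u 0 = v 0 ∧ (augmentedCube (n + 1)).Adj (Fin.tail u) (Fin.tail v)) ∨
        (u 0 ≠ v 0 ∧ ((∀ i, Fin.tail u i = Fin.tail v i) ∨ (∀ i, Fin.tail u i ≠ Fin.tail v i)))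
      symm := ⟨by
        rintro u v (⟨h, h'⟩ | ⟨h, h' | h'⟩)
        · exact Or.inl ⟨h.symm, h'.symm⟩
        · exact Or.inr ⟨h.symm, Or.inl fun i => (h' i).symm⟩
        · exact Or.inr ⟨h.symm, Or.inr fun i => (h' i).symm⟩⟩
      loopless := ⟨by
        rintro u (⟨_, h⟩ | ⟨h, _⟩)
        · exact (augmentedCube (n + 1)).irrefl h
        · exact h rfl⟩ }

open Classical in
/-- `f : E(G) → [0,1]` is a fractional perfect matching: at every vertex the weights of the
incident edges add up to `1`. -/
def IsFractionalPerfectMatching {V : Type*} [Fintype V] (G : SimpleGraph V)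
    (f : G.edgeSet → ℝ) : Prop :=
  (∀ e, 0 ≤ f e ∧ f e ≤ 1) ∧
    ∀ v : V, ∑ e : G.edgeSet with v ∈ e.1, f e = 1

/-- `G` has an isolated vertex. -/
def HasIsolatedVertex {V : Type*} (G : SimpleGraph V) : Prop :=
  ∃ v, ∀ w, ¬ G.Adj v w

/-- `G - F` for a set `F` of vertices and edges of `G`, as a subgraph of `G`: the vertices in `F`
(with all edges at them) and the edges in `F` are deleted. -/
def deleteFaults {V : Type*} (G : SimpleGraph V) (F : Finset (V ⊕ G.edgeSet)) : G.Subgraph :=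
  ((⊤ : G.Subgraph).deleteVerts {v | Sum.inl v ∈ F}).deleteEdges
    {e | ∃ h : e ∈ G.edgeSet, Sum.inr ⟨e, h⟩ ∈ F}

open Classical in
/-- A set `F` of vertices and edges of `G` is a fractional strong matching preclusion set if
`G - F` has no fractional perfect matching. -/
def IsFSMPSet {V : Type*} [Fintype V] (G : SimpleGraph V) (F : Finset (V ⊕ G.edgeSet)) : Prop :=
  ¬ ∃ f, (G.deleteFaults F).coe.IsFractionalPerfectMatching f

/-- The fractional strong matching preclusion number: the minimum size of an FSMP set. (If `V` is
nonempty, then the set of all edges is an FSMP set, so that the minimum exists.) -/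
noncomputable def fsmp {V : Type*} [Fintype V] (G : SimpleGraph V) : ℕ :=
  sInf {k | ∃ F : Finset (V ⊕ G.edgeSet), G.IsFSMPSet F ∧ F.card = k}

open Classical in
/-- `fsmp(G) = δ(G)`. -/
def IsFractionalStronglyMaximallyMatched {V : Type*} [Fintype V] (G : SimpleGraph V) : Prop :=
  G.fsmp = G.minDegree

/-- `fsmp(G) = δ(G)` and `G - F` has an isolated vertex for every FSMP set `F` of minimum size. -/
def IsFractionalStronglySuperMatched {V : Type*} [Fintype V] (G : SimpleGraph V) : Prop :=
  G.IsFractionalStronglyMaximallyMatched ∧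
    ∀ F : Finset (V ⊕ G.edgeSet), G.IsFSMPSet F → F.card = G.fsmp →
      (G.deleteFaults F).coe.HasIsolatedVertex

end SimpleGraph

/-! By Hall's theorem, if `G - F` has no fractional perfect matching, some set `I` independent in `G
- F` has fewer than `#I` neighbours there. All edges of `G` inside `I` are then faults, and each
vertex of `N[I]` outside `I` that is no longer a neighbour costs a further fault. Hence `e(I) +
#N[I] ≤ #F + 2 * #I - 1`, with `e(I)` and `N[I]` taken in `G`. In `AQ_4`, `2 * #I + 7 ≤ e(I) +
#N[I]` whenever `2 ≤ #I`, which forces `8 ≤ #F`. So at most 7 faults leave only `#I = 1`: an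
isolated vertex, which costs 7 faults. The bound is reduced by `two_mul_card_add_le` to sets
inducing maximum degree at most 1, which are enumerated. -/

namespace SimpleGraph

open scoped Finset

/-! ### Fractional perfect matchings and Hall's condition. -/

section FractionalPerfectMatching

variable {W : Type*} [Fintype W] (K : SimpleGraph W)

open Classical in
/-- A permutation moving every vertex to a neighbour yields a fractional perfect matching. -/
theorem exists_isFractionalPerfectMatching_of_perm (σ : Equiv.Perm W) (hσ : ∀ v, K.Adj v (σ v)) :
    ∃ f, K.IsFractionalPerfectMatching f := by
  -- A 2-cycle of `σ` gives its edge weight 1; edges along longer cycles get 1/2.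
  let f : K.edgeSet → ℝ := fun e => (#{w | s(w, σ w) = e.1} : ℝ) / 2
  have hnn : ∀ e, 0 ≤ f e := fun e => by positivity
  have hsum : ∀ v : W, ∑ e : K.edgeSet with v ∈ e.1, f e = 1 := by
    intro v
    have hcard : ∑ e : K.edgeSet with v ∈ e.1, #{w | s(w, σ w) = e.1} = 2 := by
      have hpair : ({w | v ∈ s(w, σ w)} : Finset W) = {v, σ.symm v} := by
        ext w
        simp only [Finset.mem_filter, Finset.mem_univ, true_and, Sym2.mem_iff, Finset.mem_insert,
          Finset.mem_singleton, Equiv.eq_symm_apply]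
        exact or_congr eq_comm eq_comm
      have hne : v ≠ σ.symm v := by
        intro h
        have := hσ v
        rw [(Equiv.eq_symm_apply σ).1 h] at this
        exact K.irrefl this
      rw [← Finset.card_pair hne, ← hpair,
        Finset.card_eq_sum_card_fiberwise (f := fun w => (⟨s(w, σ w), hσ w⟩ : K.edgeSet))
          (t := {e : K.edgeSet | v ∈ e.1}) (fun w hw => by simpa using hw)]
      refine Finset.sum_congr rfl fun e he => ?_
      congr 1
      ext w
      simp only [Finset.mem_filter, Finset.mem_univ, true_and, Subtype.ext_iff] at he ⊢
      constructor
      · exact fun h => ⟨h ▸ he, h⟩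
      · exact fun h => h.2
    have : (∑ e : K.edgeSet with v ∈ e.1, (#{w | s(w, σ w) = e.1} : ℝ)) = 2 := by
      exact_mod_cast hcard
    simp only [f, ← Finset.sum_div, this]
    norm_num
  refine ⟨f, fun e => ⟨hnn e, ?_⟩, hsum⟩
  obtain ⟨v, hv⟩ : ∃ v, v ∈ e.1 := ⟨_, Sym2.out_fst_mem e.1⟩
  rw [← hsum v]
  exact Finset.single_le_sum (fun e _ => hnn e) (by simpa using hv)

open Classical in
/-- A graph without fractional perfect matching has an independent set with too few neighbours. -/
theorem exists_isIndepSet_of_not_isFractionalPerfectMatching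
    (h : ¬ ∃ f, K.IsFractionalPerfectMatching f) :
    ∃ I : Finset W, (∀ u ∈ I, ∀ v ∈ I, ¬ K.Adj u v) ∧
      #{w | ∃ v ∈ I, K.Adj v w} < #I := by
  by_contra! hI
  apply h
  have hall : ∀ A : Finset W, #A ≤ #(A.biUnion fun v => K.neighborFinset v) := by
    intro A
    set N := A.biUnion fun v => K.neighborFinset v
    -- `A \ N` is independent with all its neighbours in `N \ A`; adding `#(A ∩ N)` to both sides
    -- gives Hall's condition for `A`.
    have hN : ∀ w, w ∈ N ↔ ∃ v ∈ A, K.Adj v w := by simp [N]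
    have h1 := hI (A \ N) fun u hu v hv huv =>
      (Finset.mem_sdiff.1 hv).2 ((hN v).2 ⟨u, (Finset.mem_sdiff.1 hu).1, huv⟩)
    have h2 : ({w | ∃ v ∈ A \ N, K.Adj v w} : Finset W) ⊆ N \ A := by
      intro w hw
      obtain ⟨v, hv, hvw⟩ := (Finset.mem_filter.1 hw).2
      rw [Finset.mem_sdiff] at hv ⊢
      exact ⟨(hN w).2 ⟨v, hv.1, hvw⟩, fun hwA => hv.2 ((hN v).2 ⟨w, hwA, hvw.symm⟩)⟩
    have h3 := h1.trans (Finset.card_le_card h2)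
    have h4 := Finset.card_sdiff_add_card_inter A N
    have h5 := Finset.card_sdiff_add_card_inter N A
    rw [Finset.inter_comm] at h5
    omega
  obtain ⟨g, hg, hgN⟩ :=
    (Finset.all_card_le_biUnion_card_iff_exists_injective fun v => K.neighborFinset v).1 hall
  exact K.exists_isFractionalPerfectMatching_of_perm
    (Equiv.ofBijective g (Finite.injective_iff_bijective.1 hg)) fun v => by simpa using hgN v

theorem not_isFractionalPerfectMatching_of_hasIsolatedVertex (h : K.HasIsolatedVertex) :
    ¬ ∃ f, K.IsFractionalPerfectMatching f := by
  classical
  rintro ⟨f, -, hf⟩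
  obtain ⟨v, hv⟩ := h
  have := hf v
  rw [Finset.sum_eq_zero] at this
  · exact zero_ne_one this
  · intro e he
    obtain ⟨e, hadj⟩ := e
    obtain ⟨w, rfl⟩ := (Finset.mem_filter.1 he).2
    exact absurd hadj (hv w)

end FractionalPerfectMatching

/-! ### Counting the faults forced by an independent set. -/

section Faults

variable {V : Type*} (G : SimpleGraph V)

theorem mem_verts_deleteFaults {F : Finset (V ⊕ G.edgeSet)} {v : V} :
    v ∈ (G.deleteFaults F).verts ↔ Sum.inl v ∉ F := by
  simp [deleteFaults]

theorem deleteFaults_adj {F : Finset (V ⊕ G.edgeSet)} {u v : V} :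
    (G.deleteFaults F).Adj u v ↔ ∃ h : G.Adj u v, Sum.inl u ∉ F ∧ Sum.inl v ∉ F ∧
      Sum.inr ⟨s(u, v), h⟩ ∉ F := by
  simp [deleteFaults]
  tauto

/-- Deleting the neighbours of a vertex isolates it. -/
theorem hasIsolatedVertex_deleteFaults_neighborFinset (v : V) [Fintype (G.neighborSet v)] :
    (G.deleteFaults ((G.neighborFinset v).map ⟨Sum.inl, Sum.inl_injective⟩)).coe
      |>.HasIsolatedVertex := by
  refine ⟨⟨v, by simp [mem_verts_deleteFaults]⟩, fun w hw => ?_⟩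
  rw [Subgraph.coe_adj, deleteFaults_adj] at hw
  obtain ⟨h, -, h', -⟩ := hw
  exact h' (by simpa using h)

variable [Fintype V]

open Classical in
/-- If `G - F` has no fractional perfect matching, then this is due to a set `I` of vertices that
is independent in `G - F` and has fewer than `#I` neighbours in `G - F`. -/
theorem IsFSMPSet.exists_isIndepSet {F : Finset (V ⊕ G.edgeSet)} (hF : G.IsFSMPSet F) :
    ∃ I : Finset V, (∀ v ∈ I, Sum.inl v ∉ F) ∧
      (∀ u ∈ I, ∀ v ∈ I, ¬ (G.deleteFaults F).Adj u v) ∧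
      #{w | ∃ v ∈ I, (G.deleteFaults F).Adj v w} < #I := by
  obtain ⟨I, hI, hcard⟩ := exists_isIndepSet_of_not_isFractionalPerfectMatching _ hF
  refine ⟨I.map (Function.Embedding.subtype _), ?_, ?_, ?_⟩
  · intro v hv
    obtain ⟨v, -, rfl⟩ := Finset.mem_map.1 hv
    exact G.mem_verts_deleteFaults.1 v.2
  · intro u hu v hv
    obtain ⟨u, hu', rfl⟩ := Finset.mem_map.1 hu
    obtain ⟨v, hv', rfl⟩ := Finset.mem_map.1 hv
    exact hI u hu' v hv'
  · rw [Finset.card_map]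
    refine lt_of_le_of_lt ?_ hcard
    rw [← Finset.card_map (Function.Embedding.subtype _)]
    refine Finset.card_le_card fun w hw => ?_
    obtain ⟨v, hv, hvw⟩ := (Finset.mem_filter.1 hw).2
    obtain ⟨v, hv', rfl⟩ := Finset.mem_map.1 hv
    refine Finset.mem_map.2 ⟨⟨w, hvw.snd_mem⟩, ?_, rfl⟩
    exact Finset.mem_filter.2 ⟨Finset.mem_univ _, v, hv', hvw⟩

variable [DecidableEq V] [DecidableRel G.Adj]

/-- The vertices that are in `I` or have a neighbour in `I`. -/
def closedNeighborhood (I : Finset V) : Finset V := {w | ∃ v ∈ I, v = w ∨ G.Adj v w}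

/-- The edges with both ends in `I`. -/
def edgesWithin (I : Finset V) : Finset G.edgeSet := {e | ∀ v ∈ e.1, v ∈ I}

-- The edges inside `I` and one fault for each lost neighbour in `B` are pairwise distinct elements
-- of `F`.
open Classical in
theorem card_edgesWithin_add_card_closedNeighborhood_le {F : Finset (V ⊕ G.edgeSet)} {I : Finset V}
    (hIF : ∀ v ∈ I, Sum.inl v ∉ F) (hI : ∀ u ∈ I, ∀ v ∈ I, ¬ (G.deleteFaults F).Adj u v) :
    #(G.edgesWithin I) + #(G.closedNeighborhood I) ≤
      #F + #{w | ∃ v ∈ I, (G.deleteFaults F).Adj v w} + #I := by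
  set N : Finset V := {w | ∃ v ∈ I, (G.deleteFaults F).Adj v w}
  set B : Finset V := G.closedNeighborhood I \ (N ∪ I)
  have hB : ∀ w ∈ B, w ∉ I ∧ ∃ x ∈ F, x = Sum.inl w ∨
      ∃ (e : G.edgeSet) (v : V), x = Sum.inr e ∧ v ∈ I ∧ e.1 = s(v, w) := by
    intro w hw
    simp only [B, N, closedNeighborhood, Finset.mem_sdiff, Finset.mem_union, Finset.mem_filter,
      Finset.mem_univ, true_and, not_or, not_exists, not_and] at hw
    obtain ⟨⟨v, hv, rfl | hvw⟩, hN, hwI⟩ := hw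
    · exact absurd hv hwI
    refine ⟨hwI, ?_⟩
    by_cases hwF : Sum.inl w ∈ F
    · exact ⟨_, hwF, Or.inl rfl⟩
    · refine ⟨Sum.inr ⟨s(v, w), hvw⟩, ?_, Or.inr ⟨_, v, rfl, hv, rfl⟩⟩
      by_contra hF
      exact hN v hv (G.deleteFaults_adj.2 ⟨hvw, hIF v hv, hwF, hF⟩)
  choose! hBI g hgF hg using hB
  have hinj : Set.InjOn g B := by
    intro w hw w' hw' h
    rcases hg w hw with h1 | ⟨e, v, h1, hv, he⟩ <;>
      rcases hg w' hw' with h2 | ⟨e', v', h2, hv', he'⟩ <;> rw [h1, h2] at h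
    · exact Sum.inl_injective h
    · cases h
    · cases h
    -- A faulty edge has one end in `I` and the other outside, so it accounts for only one lost
    -- neighbour.
    · obtain rfl := Sum.inr_injective h
      rw [he] at he'
      have : w ∈ s(v', w') := he' ▸ Sym2.mem_mk_right v w
      rcases Sym2.mem_iff.1 this with rfl | rfl
      · exact absurd hv' (hBI w hw)
      · rfl
  have hdisj : Disjoint ((G.edgesWithin I).map ⟨Sum.inr, Sum.inr_injective⟩) (B.image g) := by
    rw [Finset.disjoint_left]
    intro x hx hx'
    obtain ⟨e, he, rfl⟩ := Finset.mem_map.1 hx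
    obtain ⟨w, hw, hwe⟩ := Finset.mem_image.1 hx'
    rcases hg w hw with h1 | ⟨e', v, h1, hv, he'⟩ <;> rw [hwe] at h1
    · cases h1
    · obtain rfl := Sum.inr_injective h1
      refine hBI w hw ((Finset.mem_filter.1 he).2 w ?_)
      rw [he']
      exact Sym2.mem_mk_right v w
  have hsub : (G.edgesWithin I).map ⟨Sum.inr, Sum.inr_injective⟩ ∪ B.image g ⊆ F := by
    refine Finset.union_subset (fun x hx => ?_) (Finset.image_subset_iff.2 hgF)
    obtain ⟨⟨e, hadj⟩, he, rfl⟩ := Finset.mem_map.1 hx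
    replace he := (Finset.mem_filter.1 he).2
    induction e with
    | _ u v =>
    have hu := he u (Sym2.mem_mk_left u v)
    have hv := he v (Sym2.mem_mk_right u v)
    by_contra hF
    exact hI u hu v hv (G.deleteFaults_adj.2 ⟨hadj, hIF u hu, hIF v hv, hF⟩)
  have h1 := Finset.card_le_card hsub
  rw [Finset.card_union_of_disjoint hdisj, Finset.card_map, Finset.card_image_of_injOn hinj] at h1
  have h2 := Finset.le_card_sdiff (N ∪ I) (G.closedNeighborhood I)
  have h3 := Finset.card_union_le N I
  change _ ≤ #B at h2
  omega

theorem card_edgesWithin_insert {J : Finset V} {a : V} (ha : a ∉ J) :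
    #(G.edgesWithin J) + #{w ∈ J | G.Adj a w} ≤ #(G.edgesWithin (insert a J)) := by
  let g : {w // w ∈ J.filter (G.Adj a)} → G.edgeSet :=
    fun w => ⟨s(a, w.1), (Finset.mem_filter.1 w.2).2⟩
  have hg : Function.Injective g := by
    intro w w' h
    have := congrArg Subtype.val h
    exact Subtype.ext (Sym2.congr_right.1 this)
  have hdisj : Disjoint (G.edgesWithin J) (Finset.univ.map ⟨g, hg⟩) := by
    rw [Finset.disjoint_left]
    intro e he he'
    obtain ⟨w, -, rfl⟩ := Finset.mem_map.1 he'
    exact ha ((Finset.mem_filter.1 he).2 a (Sym2.mem_mk_left a w.1))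
  have hsub : G.edgesWithin J ∪ Finset.univ.map ⟨g, hg⟩ ⊆ G.edgesWithin (insert a J) := by
    intro e he
    refine Finset.mem_filter.2 ⟨Finset.mem_univ _, fun v hv => ?_⟩
    rcases Finset.mem_union.1 he with he | he
    · exact Finset.mem_insert_of_mem ((Finset.mem_filter.1 he).2 v hv)
    · obtain ⟨w, -, rfl⟩ := Finset.mem_map.1 he
      rcases Sym2.mem_iff.1 hv with rfl | rfl
      · exact Finset.mem_insert_self _ _
      · exact Finset.mem_insert_of_mem (Finset.mem_filter.1 w.2).1
  have := Finset.card_le_card hsub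
  rwa [Finset.card_union_of_disjoint hdisj, Finset.card_map, Finset.card_univ,
    Fintype.card_coe] at this

end Faults

/-! ### Reduction to sets inducing maximum degree at most 1. -/

section SparseLists

variable {V : Type*} (G : SimpleGraph V) [DecidableRel G.Adj]

/-- Every member of the list has at most one neighbour in the list. -/
def IsSparseList (s : List V) : Prop := ∀ v ∈ s, s.countP (fun w => G.Adj v w) ≤ 1

instance (s : List V) : Decidable (G.IsSparseList s) :=
  inferInstanceAs (Decidable (∀ v ∈ s, s.countP (fun w => G.Adj v w) ≤ 1))

theorem IsSparseList.of_sublist {s t : List V} (ht : G.IsSparseList t) (h : s.Sublist t) :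
    G.IsSparseList s :=
  fun v hv => (h.countP_le).trans (ht v (h.subset hv))

/-- The sparse sublists of a list. -/
def sparseSublists : List V → List (List V)
  | [] => [[]]
  | a :: l => sparseSublists l ++
      ((sparseSublists l).map (a :: ·)).filter fun s => G.IsSparseList s

/-- Sparsity passes to sublists, so pruning at each stage of the recursion loses nothing. -/
theorem mem_sparseSublists {s l : List V} (h : s.Sublist l) (hs : G.IsSparseList s) :
    s ∈ G.sparseSublists l := by
  induction h with
  | slnil => simp [sparseSublists]
  | cons a _ ih => exact List.mem_append_left _ (ih hs)
  | cons_cons a _ ih =>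
    refine List.mem_append_right _ (List.mem_filter.2 ⟨List.mem_map.2 ⟨_, ih ?_, rfl⟩, by simpa⟩)
    exact hs.of_sublist G (List.sublist_cons_self _ _)

/-- The number of adjacent pairs in a list. -/
def adjacentPairs : List V → ℕ
  | [] => 0
  | a :: s => adjacentPairs s + s.countP fun w => G.Adj a w

variable [DecidableEq V]

theorem card_filter_toFinset {s : List V} (hs : s.Nodup) (p : V → Prop) [DecidablePred p] :
    #{w ∈ s.toFinset | p w} = s.countP fun w => p w := by
  rw [List.countP_eq_length_filter, ← List.toFinset_card_of_nodup (hs.filter _),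
    List.toFinset_filter]
  simp

theorem adjacentPairs_le [Fintype V] {s : List V} (hs : s.Nodup) :
    G.adjacentPairs s ≤ #(G.edgesWithin s.toFinset) := by
  induction s with
  | nil => exact Nat.zero_le _
  | cons a s ih =>
    rw [List.nodup_cons] at hs
    have := G.card_edgesWithin_insert (J := s.toFinset) (a := a) (by simpa using hs.1)
    rw [card_filter_toFinset hs.2] at this
    rw [List.toFinset_cons]
    exact (Nat.add_le_add_right (ih hs.2) _).trans this

theorem card_closedNeighborhood_toFinset [Fintype V] {s l : List V} (hl : l.Nodup)
    (hmem : ∀ v, v ∈ l) :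
    #(G.closedNeighborhood s.toFinset) = l.countP fun w => ∃ v ∈ s, v = w ∨ G.Adj v w := by
  rw [← card_filter_toFinset hl]
  congr 1
  ext w
  simp [closedNeighborhood, hmem]

/-- A bound for sets without vertices of degree `2` extends to all sets. -/
theorem two_mul_card_add_le [Fintype V] {l : List V} (hl : l.Nodup) (hmem : ∀ v, v ∈ l) {c : ℕ}
    (hc : ∀ s ∈ G.sparseSublists l, 2 ≤ s.length → 2 * s.length + c ≤
      G.adjacentPairs s + l.countP fun w => ∃ v ∈ s, v = w ∨ G.Adj v w)
    (I : Finset V) (hI : 2 ≤ #I) :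
    2 * #I + c ≤ #(G.edgesWithin I) + #(G.closedNeighborhood I) := by
  induction I using Finset.strongInduction with
  | H I ih =>
  by_cases h : ∃ v ∈ I, 2 ≤ #{w ∈ I | G.Adj v w}
  -- Erasing `v` lowers `2 * #I` by 2 and the edge count by at least 2, and does not enlarge the
  -- closed neighbourhood. The two neighbours of `v` remain, so induction applies.
  · obtain ⟨v, hv, h2⟩ := h
    have hfilter : ({w ∈ I | G.Adj v w} : Finset V) = {w ∈ I.erase v | G.Adj v w} := by
      ext w
      simp only [Finset.mem_filter, Finset.mem_erase]
      exact ⟨fun h => ⟨⟨h.2.ne', h.1⟩, h.2⟩, fun h => ⟨h.1.2, h.2⟩⟩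
    rw [hfilter] at h2
    have h3 := Finset.card_filter_le (I.erase v) (G.Adj v)
    have h4 := ih _ (Finset.erase_ssubset hv) (h2.trans h3)
    have h5 := G.card_edgesWithin_insert (Finset.notMem_erase v I)
    have h6 : #(G.closedNeighborhood (I.erase v)) ≤ #(G.closedNeighborhood I) := by
      refine Finset.card_le_card (Finset.monotone_filter_right _ fun w _ => ?_)
      rintro ⟨u, hu, huw⟩
      exact ⟨u, Finset.mem_of_mem_erase hu, huw⟩
    rw [Finset.insert_erase hv] at h5
    have h7 := Finset.card_erase_add_one hv
    omega
  · push Not at h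
    let s := l.filter (· ∈ I)
    have hs : s.Nodup := hl.filter _
    have hsI : s.toFinset = I := by
      ext w
      simp [s, hmem]
    have hlen : s.length = #I := by rw [← hsI, List.toFinset_card_of_nodup hs]
    have hsparse : G.IsSparseList s := by
      intro v hv
      rw [← card_filter_toFinset hs, hsI]
      exact Nat.le_of_lt_succ (h v (by rw [← hsI]; simpa using hv))
    have h1 := hc s (G.mem_sparseSublists List.filter_sublist hsparse) (hlen ▸ hI)
    rw [← G.card_closedNeighborhood_toFinset hl hmem, hsI, hlen] at h1
    have h2 := G.adjacentPairs_le hs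
    rw [hsI] at h2
    omega

end SparseLists

/-! ### The four-dimensional augmented cube. -/

section AugmentedCubeFour

/-- The number with the given binary digits, the first one being the most significant. -/
def binaryValue (u : Fin 4 → Bool) : ℕ :=
  8 * (u 0).toNat + 4 * (u 1).toNat + 2 * (u 2).toNat + (u 3).toNat

/-- The masks 1, 2, 4, 8 flip one digit; 3, 7, 15 complement a suffix. This form makes adjacency
computable. -/
theorem augmentedCube_four_adj (u v : Fin 4 → Bool) : (augmentedCube 4).Adj u v ↔
    (binaryValue u ^^^ binaryValue v) ∈ [1, 2, 3, 4, 7, 8, 15] := by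
  simp only [augmentedCube, top_adj, ne_eq, funext_iff, Fin.tail, Fin.forall_fin_succ,
    IsEmpty.forall_iff, and_true, binaryValue]
  revert u v
  decide +kernel

instance : DecidableRel (augmentedCube 4).Adj :=
  fun u v => decidable_of_iff' _ (augmentedCube_four_adj u v)

/-- The vertices of the four-dimensional cube. -/
def binaryStrings : List (Fin 4 → Bool) :=
  (List.range 16).map fun n i => n.testBit (3 - i)

theorem nodup_binaryStrings : binaryStrings.Nodup := by decide +kernel

theorem mem_binaryStrings : ∀ v, v ∈ binaryStrings := by decide +kernel

theorem degree_augmentedCube_four : ∀ v, (augmentedCube 4).degree v = 7 := by decide +kernel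

theorem card_closedNeighborhood_singleton :
    ∀ v, #((augmentedCube 4).closedNeighborhood {v}) = 8 := by decide +kernel

theorem sparseSublists_bound : ∀ s ∈ (augmentedCube 4).sparseSublists binaryStrings,
    2 ≤ s.length → 2 * s.length + 7 ≤ (augmentedCube 4).adjacentPairs s +
      binaryStrings.countP fun w => ∃ v ∈ s, v = w ∨ (augmentedCube 4).Adj v w := by
  decide +kernel

theorem IsFSMPSet.hasIsolatedVertex_of_card_le_seven
    {F : Finset ((Fin 4 → Bool) ⊕ (augmentedCube 4).edgeSet)}
    (hF : (augmentedCube 4).IsFSMPSet F) (hcard : #F ≤ 7) :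
    #F = 7 ∧ ((augmentedCube 4).deleteFaults F).coe.HasIsolatedVertex := by
  classical
  obtain ⟨I, hIF, hI, hN⟩ := hF.exists_isIndepSet
  have h1 := (augmentedCube 4).card_edgesWithin_add_card_closedNeighborhood_le hIF hI
  by_cases h2 : 2 ≤ #I
  · have := (augmentedCube 4).two_mul_card_add_le nodup_binaryStrings mem_binaryStrings
      sparseSublists_bound I h2
    omega
  · obtain ⟨v, rfl⟩ := Finset.card_eq_one.1 (show #I = 1 by omega)
    rw [Finset.card_singleton, Nat.lt_one_iff] at hN
    rw [card_closedNeighborhood_singleton, hN, Finset.card_singleton] at h1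
    refine ⟨by omega, ⟨v, (augmentedCube 4).mem_verts_deleteFaults.2 (hIF v (by simp))⟩, ?_⟩
    intro w hw
    have := Finset.filter_eq_empty_iff.1 (Finset.card_eq_zero.1 hN) (Finset.mem_univ w.1)
    exact this ⟨v, by simp, hw⟩

theorem exists_isFSMPSet_card_eq_seven : ∃ F, (augmentedCube 4).IsFSMPSet F ∧ #F = 7 := by
  classical
  refine ⟨((augmentedCube 4).neighborFinset 0).map ⟨Sum.inl, Sum.inl_injective⟩,
    not_isFractionalPerfectMatching_of_hasIsolatedVertex _
      ((augmentedCube 4).hasIsolatedVertex_deleteFaults_neighborFinset 0), ?_⟩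
  rw [Finset.card_map, card_neighborFinset_eq_degree, degree_augmentedCube_four]

theorem fsmp_augmentedCube_four : (augmentedCube 4).fsmp = 7 := by
  have hmem := Nat.sInf_mem (s := {k | ∃ F, (augmentedCube 4).IsFSMPSet F ∧ #F = k})
    ⟨7, exists_isFSMPSet_card_eq_seven⟩
  have hle : (augmentedCube 4).fsmp ≤ 7 := Nat.sInf_le exists_isFSMPSet_card_eq_seven
  obtain ⟨F, hF, hcard⟩ := hmem
  change #F = (augmentedCube 4).fsmp at hcard
  rw [← hcard] at hle ⊢
  exact (hF.hasIsolatedVertex_of_card_le_seven hle).1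

theorem isFractionalStronglyMaximallyMatched_augmentedCube_four :
    (augmentedCube 4).IsFractionalStronglyMaximallyMatched := by
  obtain ⟨v, hv⟩ := (augmentedCube 4).exists_minimal_degree_vertex
  rw [IsFractionalStronglyMaximallyMatched, fsmp_augmentedCube_four,
    ← degree_augmentedCube_four v, ← hv]
  -- The two sides differ only in their decidability instances.
  congr!

end AugmentedCubeFour

end SimpleGraph

theorem lemma4p1 :
    (SimpleGraph.augmentedCube 4).IsFractionalStronglyMaximallyMatched ∧
      (SimpleGraph.augmentedCube 4).IsFractionalStronglySuperMatched := by
  refine ⟨SimpleGraph.isFractionalStronglyMaximallyMatched_augmentedCube_four,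
    SimpleGraph.isFractionalStronglyMaximallyMatched_augmentedCube_four, fun F hF hcard => ?_⟩
  rw [SimpleGraph.fsmp_augmentedCube_four] at hcard
  exact (hF.hasIsolatedVertex_of_card_le_seven hcard.le).2
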